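/- Let $(r_n)_{n\ge 0} = 1, 2, 6, 22, 90, \dots$ be the large Schröder numbers and $(s_n)_{n\ge 0} = 1, 1, 3, 11, 45, \dots$ the little Schröder numbers (so $r_0=s_0=1$ and $r_n=2s_n$ for $n\ge 1$). For $0\le k\le n$ let $$B_{n,k}(z_1,z_2,\dots)=\sum_{\alpha}\frac{n!}{\alpha_1!\,\alpha_2!\cdots}\left(\frac{z_1}{1!}\right)^{\alpha_1}\left(\frac{z_2}{2!}\right)^{\alpha_2}\cdots$$ be the $(n,k)$-th exponential partial Bell polynomial, where the sum is over all $\alpha\in\mathbb{N}_0^{\,n-k+1}$ with $\alpha_1+\alpha_2+\cdots=k$ and $\alpha_1+2\alpha_2+3\alpha_3+\cdots=n$. Then, for all integers $1\le k<n$, $$\begin{aligned} B_{n,k}(1!\,r_0,\,2!\,r_1,\,3!\,r_2,\dots) &=\sum_{\ell=0}^{k}(-1)^{\ell}\,2^{k-\ell}\binom{n}{\ell}\,B_{n-\ell,\,k-\ell}(1!\,s_0,\,2!\,s_1,\,3!\,s_2,\dots)\\ &=\frac{n!}{(k-1)!}\sum_{\ell=0}^{k}\sum_{j=1}^{n-k}\frac{(-1)^{\ell}\,2^{k-\ell}}{j}\binom{k-1}{\ell}\binom{n-k-1}{j-1}\binom{n-\ell+j-1}{j-1}.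 \end{aligned}$$ -/

import Mathlib

open scoped Nat

/-- The set `π(n,k)` of multi-indices `α = (α₁, …, α_{n-k+1})` of natural numbers with
`α₁ + α₂ + ⋯ = k` and `α₁ + 2 α₂ + 3 α₃ + ⋯ = n`. The entry `α_{i+1}` is `α i` for
`i : Fin (n - k + 1)`. (Bounding the entries by `k` only serves to have a finite set,
see `mem_bellIndex`.) -/
def bellIndex (n k : ℕ) : Finset (Fin (n - k + 1) → ℕ) :=
  (Fintype.piFinset fun _ => Finset.range (k + 1)).filter fun α =>
    ∑ i, α i = k ∧ ∑ i : Fin (n - k + 1), ((i : ℕ) + 1) * α i = n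

theorem mem_bellIndex (n k : ℕ) (α : Fin (n - k + 1) → ℕ) :
    α ∈ bellIndex n k ↔ ∑ i, α i = k ∧ ∑ i : Fin (n - k + 1), ((i : ℕ) + 1) * α i = n := by
  simp only [bellIndex, Finset.mem_filter, Fintype.mem_piFinset, Finset.mem_range,
    and_iff_right_iff_imp]
  rintro ⟨h, -⟩ i
  have := Finset.single_le_sum (f := α) (fun j _ => Nat.zero_le _) (Finset.mem_univ i)
  omega

/-- The value `B_{n,k}(z₁, …, z_{n-k+1})` of the `(n,k)`-th exponential partial Bell polynomial,
for `0 ≤ k ≤ n`. The sequence of arguments is indexed from `0`, i.e. `z i` is the argument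
`z_{i+1}`. -/
def partialBell (n k : ℕ) (z : ℕ → ℚ) : ℚ :=
  ∑ α ∈ bellIndex n k,
    (n ! : ℚ) / (∏ i, (α i)! : ℕ) * ∏ i : Fin (n - k + 1), (z i / (((i : ℕ) + 1)! : ℚ)) ^ α i

/-- The little Schröder numbers `s₀, s₁, s₂, … = 1, 1, 3, 11, 45, 197, …`. Mathlib's
`Nat.smallSchroder` is the same sequence with an additional leading `1`, namely
`1, 1, 1, 3, 11, 45, …`, so the index is shifted by one. -/
def littleSchroder (n : ℕ) : ℕ := Nat.smallSchroder (n + 1)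

/-! With arguments `(i + 1)! * a i`, the Bell polynomial is `n! / k!` times the coefficient of `X ^
(n - k)` in the `k`-th power of the generating function of `a`. Since `R = 2 S - 1` for the large
and little series, expanding `(2 S - 1) ^ k` binomially gives the first formula. For the second, `y
= X S` satisfies `S = φ(y)` with `φ = (1 - X) / (1 - 2 X)`, so Lagrange inversion reduces powers of
`S` to powers of `φ`, which are expanded in `X / (1 - X)`. -/

namespace PowerSeries

/-- The generating function of the little Schröder numbers. -/
noncomputable def littleSchroderSeries : ℚ⟦X⟧ := mk fun i => (littleSchroder i : ℚ)

@[simp]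
theorem constantCoeff_littleSchroderSeries : constantCoeff littleSchroderSeries = 1 := by
  simp [littleSchroderSeries, littleSchroder]

theorem map_largeSchroderSeries_eq :
    map (Nat.castRingHom ℚ) largeSchroderSeries = 2 * littleSchroderSeries - 1 := by
  ext i
  rw [map_sub, ← map_ofNat (C (R := ℚ)) 2, coeff_C_mul, coeff_map, coeff_largeSchroderSeries,
    coeff_one, littleSchroderSeries, coeff_mk, littleSchroder, eq_natCast]
  rcases eq_or_ne i 0 with rfl | hi
  · norm_num
  · rw [if_neg hi, ← Nat.two_mul_smallSchroder_succ hi]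
    push_cast
    ring

theorem littleSchroderSeries_eq :
    littleSchroderSeries =
      1 + X * littleSchroderSeries * (2 * littleSchroderSeries - 1) := by
  have h := congrArg (map (Nat.castRingHom ℚ))
    largeSchroderSeries_eq_one_add_X_mul_largeSchroderSeries_add_X_mul_largeSchroderSeries_sq
  simp only [map_add, map_mul, map_pow, map_X, map_one, map_largeSchroderSeries_eq] at h
  have h2 : (2 : ℚ⟦X⟧) ≠ 0 := by
    rw [← map_ofNat (C (R := ℚ)) 2]
    exact (map_ne_zero_iff C C_injective).2 two_ne_zero
  apply mul_left_cancel₀ h2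
  linear_combination h

theorem coeff_pow_succ_littleSchroderSeries (p m : ℕ) :
    coeff (m + 1) (littleSchroderSeries ^ (p + 1)) =
      coeff (m + 1) (littleSchroderSeries ^ p) + 2 * coeff m (littleSchroderSeries ^ (p + 2)) -
        coeff m (littleSchroderSeries ^ (p + 1)) := by
  have h : littleSchroderSeries ^ (p + 1) = littleSchroderSeries ^ p +
      X * (C 2 * littleSchroderSeries ^ (p + 2) - littleSchroderSeries ^ (p + 1)) := by
    rw [map_ofNat]
    linear_combination littleSchroderSeries ^ p * littleSchroderSeries_eq
  conv_lhs => rw [h]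
  rw [map_add, coeff_succ_X_mul, map_sub, coeff_C_mul]
  ring

/-- The power series `(1 - X) / (1 - 2 X)`. -/
noncomputable def oneSubDivOneSubTwo : ℚ⟦X⟧ := (1 - X) * (1 - C 2 * X)⁻¹

theorem one_sub_two_mul_oneSubDivOneSubTwo : (1 - C 2 * X) * oneSubDivOneSubTwo = 1 - X := by
  rw [oneSubDivOneSubTwo, mul_left_comm, PowerSeries.mul_inv_cancel _ (by simp), mul_one]

@[simp]
theorem constantCoeff_oneSubDivOneSubTwo : constantCoeff oneSubDivOneSubTwo = 1 := by
  simp [oneSubDivOneSubTwo]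

theorem coeff_succ_one_sub_C_mul_X_mul (a : ℚ) (f : ℚ⟦X⟧) (m : ℕ) :
    coeff (m + 1) ((1 - C a * X) * f) = coeff (m + 1) f - a * coeff m f := by
  rw [sub_mul, one_mul, mul_assoc, map_sub, coeff_C_mul, coeff_succ_X_mul]

theorem coeff_succ_one_sub_X_mul (f : ℚ⟦X⟧) (m : ℕ) :
    coeff (m + 1) ((1 - X) * f) = coeff (m + 1) f - coeff m f := by
  simpa using coeff_succ_one_sub_C_mul_X_mul 1 f m

theorem coeff_oneSubDivOneSubTwo_pow_succ (n m : ℕ) :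
    coeff (m + 1) (oneSubDivOneSubTwo ^ (n + 1)) - 2 * coeff m (oneSubDivOneSubTwo ^ (n + 1)) =
      coeff (m + 1) (oneSubDivOneSubTwo ^ n) - coeff m (oneSubDivOneSubTwo ^ n) := by
  rw [← coeff_succ_one_sub_C_mul_X_mul, ← coeff_succ_one_sub_X_mul, pow_succ', ← mul_assoc,
    one_sub_two_mul_oneSubDivOneSubTwo]

/-- Both sides come from `n (n + 1) (1 - X) φ ^ (n - 1) φ'`, as `(1 - 2 X) φ = 1 - X`. -/
theorem coeff_derivative_oneSubDivOneSubTwo_pow_succ (n m : ℕ) :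
    (n : ℚ) * ((m + 1) * coeff (m + 1) (oneSubDivOneSubTwo ^ (n + 1)) -
        2 * (m * coeff m (oneSubDivOneSubTwo ^ (n + 1)))) =
      (n + 1) * ((m + 1) * coeff (m + 1) (oneSubDivOneSubTwo ^ n) -
        m * coeff m (oneSubDivOneSubTwo ^ n)) := by
  have key : C (n : ℚ) * ((1 - C 2 * X) * (d⁄dX ℚ (oneSubDivOneSubTwo ^ (n + 1)))) =
      C (n + 1 : ℚ) * ((1 - X) * (d⁄dX ℚ (oneSubDivOneSubTwo ^ n))) := by
    rw [← one_sub_two_mul_oneSubDivOneSubTwo, derivative_pow, derivative_pow]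
    rcases n with _ | n
    · simp
    · simp only [Nat.add_sub_cancel, map_add, map_one, map_natCast]
      push_cast
      ring
  have h := congrArg (coeff m) key
  rw [coeff_C_mul, coeff_C_mul] at h
  rcases m with _ | m
  · simp only [coeff_zero_eq_constantCoeff_apply, map_mul, map_sub, map_one, constantCoeff_X,
      mul_zero, sub_zero, one_mul] at h
    simp only [← coeff_zero_eq_constantCoeff_apply, coeff_derivative] at h
    push_cast at h ⊢
    linear_combination h
  · rw [coeff_succ_one_sub_C_mul_X_mul, coeff_succ_one_sub_X_mul] at h
    simp only [coeff_derivative] at h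
    push_cast at h ⊢
    linear_combination h

/-- Lagrange inversion for powers of the generating function of the little Schröder numbers. -/
theorem add_mul_coeff_littleSchroderSeries_pow (m p : ℕ) :
    ((m : ℚ) + p) * coeff m (littleSchroderSeries ^ p) =
      p * coeff m (oneSubDivOneSubTwo ^ (m + p)) := by
  -- The recurrence from the functional equation reduces `(m + 1, p + 1)` to `(m + 1, p)`, `(m, p +
  -- 2)` and `(m, p + 1)`, hence the nested induction. Only `φ ^ (m + p + 1)` and `φ ^ (m + p + 2)`
  -- then occur, and `hc`, `hd` link their coefficients.
  induction m generalizing p with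
  | zero => simp
  | succ m ihm =>
    induction p with
    | zero => simp [coeff_one]
    | succ p ihp =>
      have h1 := ihm (p + 1)
      have h2 := ihm (p + 2)
      have hc := coeff_oneSubDivOneSubTwo_pow_succ (m + p + 1) m
      have hd := coeff_derivative_oneSubDivOneSubTwo_pow_succ (m + p + 1) m
      rw [coeff_pow_succ_littleSchroderSeries]
      rw [show m + 1 + p = m + p + 1 by ring] at ihp
      rw [show m + (p + 1) = m + p + 1 by ring] at h1
      rw [show m + (p + 2) = m + p + 1 + 1 by ring] at h2
      rw [show m + 1 + (p + 1) = m + p + 1 + 1 by ring]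
      push_cast at *
      have h0 : (m + p + 1 : ℚ) ≠ 0 := by positivity
      apply mul_left_cancel₀ h0
      linear_combination (m + p + 2 : ℚ) * (ihp - h1) + 2 * (m + p + 1) * h2 +
        (- (m + p + 1 : ℚ) * (m + p + 2)) * hc + hd

theorem hasSubst_X_mul_mk_one : HasSubst (X * mk 1 : ℚ⟦X⟧) :=
  .of_constantCoeff_zero' (by simp)

theorem coeff_X_mul_mk_one_pow_succ (m j : ℕ) :
    coeff (m + 1) ((X * mk 1 : ℚ⟦X⟧) ^ (j + 1)) = m.choose j := by
  rw [mul_pow, mk_one_pow_eq_mk_choose_add, coeff_X_pow_mul', coeff_mk]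
  split_ifs with h
  · congr 2; omega
  · rw [Nat.choose_eq_zero_of_lt (by omega), Nat.cast_zero]

theorem oneSubDivOneSubTwo_mul_one_sub : oneSubDivOneSubTwo * (1 - X * mk 1) = 1 := by
  have h1 : (mk 1 : ℚ⟦X⟧) * (1 - X) = 1 := mk_one_mul_one_sub_eq_one ℚ
  have h := one_sub_two_mul_oneSubDivOneSubTwo
  rw [map_ofNat] at h
  linear_combination mk 1 * h + (1 - oneSubDivOneSubTwo) * h1

theorem oneSubDivOneSubTwo_pow_succ_eq_subst (n : ℕ) :
    oneSubDivOneSubTwo ^ (n + 1) =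
      (mk fun j => ((n + j).choose n : ℚ)).subst (X * mk 1 : ℚ⟦X⟧) := by
  have h := congrArg (substAlgHom (R := ℚ) hasSubst_X_mul_mk_one)
    (mk_add_choose_mul_one_sub_pow_eq_one ℚ n)
  rw [map_mul, map_pow, map_sub, map_one, substAlgHom_X, coe_substAlgHom] at h
  have h' := congrArg (· ^ (n + 1)) oneSubDivOneSubTwo_mul_one_sub
  simp only [mul_pow, one_pow] at h'
  linear_combination (-oneSubDivOneSubTwo ^ (n + 1)) * h +
    (mk fun j => ((n + j).choose n : ℚ)).subst (X * mk 1 : ℚ⟦X⟧) * h'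

/-- Expand `φ ^ (n + 1) = (1 - u) ^ (-(n + 1))` in `u = X / (1 - X)`; the term `u ^ 0` contributes
nothing in positive degree. -/
theorem coeff_succ_oneSubDivOneSubTwo_pow_succ (n m : ℕ) :
    coeff (m + 1) (oneSubDivOneSubTwo ^ (n + 1)) =
      ∑ j ∈ Finset.range (m + 1), ((n + (j + 1)).choose n : ℚ) * (m.choose j : ℚ) := by
  rw [oneSubDivOneSubTwo_pow_succ_eq_subst, coeff_subst' hasSubst_X_mul_mk_one,
    finsum_eq_sum_of_support_subset _ (s := Finset.range (m + 2)), Finset.sum_range_succ']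
  · simp [coeff_X_mul_mk_one_pow_succ, coeff_one]
  · intro j hj
    contrapose! hj
    obtain ⟨i, rfl⟩ : ∃ i, j = i + 1 := ⟨j - 1, by simp at hj; omega⟩
    have : m < i := by simp at hj; omega
    simp [coeff_X_mul_mk_one_pow_succ, Nat.choose_eq_zero_of_lt this]

theorem coeff_littleSchroderSeries_pow {m : ℕ} (hm : 1 ≤ m) (p : ℕ) :
    coeff m (littleSchroderSeries ^ p) =
      p * ∑ j ∈ Finset.Icc 1 m,
        (1 / j : ℚ) * ((m - 1).choose (j - 1) : ℚ) * ((m + p + j - 1).choose (j - 1) : ℚ) := by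
  obtain ⟨m, rfl⟩ := Nat.exists_eq_add_of_le' hm
  have h := add_mul_coeff_littleSchroderSeries_pow (m + 1) p
  rw [show m + 1 + p = m + p + 1 by ring, coeff_succ_oneSubDivOneSubTwo_pow_succ] at h
  have h0 : (((m + 1 : ℕ) : ℚ) + p) ≠ 0 := by positivity
  apply mul_left_cancel₀ h0
  rw [h, mul_left_comm]
  congr 1
  rw [Finset.mul_sum, ← Finset.Ico_add_one_right_eq_Icc, Finset.sum_Ico_eq_sum_range]
  refine Finset.sum_congr rfl fun j _ => ?_
  -- Absorption produces the factor `m + p + 1` that cancels the Lagrange denominator, leaving `1 /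
  -- (j + 1)`.
  have e := Nat.choose_succ_right_eq (m + p + 1 + j) j
  have e1 : (m + p + (j + 1)).choose (m + p) = (m + p + 1 + j).choose (j + 1) := by
    rw [Nat.choose_symm_add, show m + p + (j + 1) = m + p + 1 + j by ring]
  rw [e1, show m + 1 + p + (1 + j) - 1 = m + p + 1 + j by omega]
  simp only [Nat.add_sub_cancel, Nat.add_sub_cancel_left]
  have e' : ((m + p + 1 + j).choose (j + 1) : ℚ) * (j + 1) =
      (m + p + 1 + j).choose j * (m + p + 1) := by
    rw [Nat.add_sub_cancel] at e
    exact_mod_cast e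
  have hj : (j + 1 : ℚ) ≠ 0 := by positivity
  push_cast
  rw [add_comm 1 (j : ℚ)]
  field_simp
  linear_combination (m.choose j : ℚ) * e'

/-- Truncating makes the finite multinomial theorem applicable. -/
theorem coeff_pow_eq_coeff_sum_pow (f : ℚ⟦X⟧) (m k : ℕ) :
    coeff m (f ^ k) =
      coeff m ((∑ i : Fin (m + 1), C (coeff (i : ℕ) f) * X ^ (i : ℕ)) ^ k) := by
  have h : (∑ i : Fin (m + 1), C (coeff (i : ℕ) f) * X ^ (i : ℕ) : ℚ⟦X⟧) = trunc (m + 1) f := by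
    ext i
    rw [Fin.sum_univ_eq_sum_range (fun i => C (coeff i f) * X ^ i), Polynomial.coeff_coe,
      coeff_trunc, map_sum]
    simp [coeff_X_pow]
  rw [h, ← coeff_coe_trunc_of_lt m.lt_succ_self, ← trunc_trunc_pow,
    coeff_coe_trunc_of_lt m.lt_succ_self]

end PowerSeries

open PowerSeries in
theorem partialBell_factorial_mul_eq {n k : ℕ} (hkn : k ≤ n) (a : ℕ → ℚ) :
    partialBell n k (fun i => ((i + 1)! : ℚ) * a i) =
      (n ! : ℚ) / (k ! : ℚ) * coeff (n - k) ((PowerSeries.mk a) ^ k) := by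
  -- Subtracting `∑ α i = k` from the weight condition turns weights `i + 1` into `i` and `n` into
  -- `n - k`.
  have hidx : bellIndex n k = (Finset.piAntidiag Finset.univ k).filter
      fun α : Fin (n - k + 1) → ℕ => ∑ i : Fin (n - k + 1), (i : ℕ) * α i = n - k := by
    ext α
    rw [mem_bellIndex, Finset.mem_filter, Finset.mem_piAntidiag]
    simp only [add_mul, one_mul, Finset.sum_add_distrib, Finset.mem_univ, implies_true, and_true]
    refine and_congr_right fun h => ?_
    rw [h]
    omega
  rw [coeff_pow_eq_coeff_sum_pow, Finset.sum_pow_eq_sum_piAntidiag, map_sum, partialBell, hidx,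
    Finset.sum_filter, Finset.mul_sum]
  refine Finset.sum_congr rfl fun α hα => ?_
  have hsum : ∑ i, α i = k := (Finset.mem_piAntidiag.1 hα).1
  have hmul : ((∏ i, (α i)! : ℕ) : ℚ) * Nat.multinomial Finset.univ α = (k ! : ℚ) := by
    have h := Nat.multinomial_spec Finset.univ α
    rw [hsum] at h
    exact_mod_cast h
  have hprod : ((∏ i, (α i)! : ℕ) : ℚ) ≠ 0 :=
    Nat.cast_ne_zero.2 (Finset.prod_ne_zero_iff.2 fun i _ => Nat.factorial_ne_zero _)
  have hk : (k ! : ℚ) ≠ 0 := Nat.cast_ne_zero.2 (Nat.factorial_ne_zero _)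
  have hcoeff : (coeff (n - k)) ((Nat.multinomial Finset.univ α : ℚ⟦X⟧) *
      ∏ i : Fin (n - k + 1), (C (coeff (i : ℕ) (PowerSeries.mk a)) * X ^ (i : ℕ)) ^ α i) =
      if ∑ i : Fin (n - k + 1), (i : ℕ) * α i = n - k then
        (Nat.multinomial Finset.univ α : ℚ) * ∏ i : Fin (n - k + 1), a i ^ α i else 0 := by
    simp_rw [mul_pow, ← pow_mul, ← map_pow]
    rw [Finset.prod_mul_distrib, Finset.prod_pow_eq_pow_sum, ← map_prod,
      ← map_natCast (C (R := ℚ)), ← mul_assoc, ← map_mul, coeff_C_mul, coeff_X_pow]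
    simp [eq_comm]
  rw [hcoeff]
  split_ifs
  · have hz : ∀ i : Fin (n - k + 1),
        (((i : ℕ) + 1)! : ℚ) * a i / (((i : ℕ) + 1)! : ℚ) = a i := fun i =>
      mul_div_cancel_left₀ _ (Nat.cast_ne_zero.2 (Nat.factorial_ne_zero _))
    simp_rw [hz]
    rw [← hmul]
    rw [← hmul] at hk
    have := right_ne_zero_of_mul hk
    field_simp
  · rw [mul_zero]

open PowerSeries in
theorem partialBell_largeSchroder_eq_sum {n k : ℕ} (hkn : k ≤ n) :
    partialBell n k (fun i => ((i + 1)! : ℚ) * (Nat.largeSchroder i : ℚ)) =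
      (n ! : ℚ) / (k ! : ℚ) * ∑ l ∈ Finset.range (k + 1), (-1 : ℚ) ^ l * 2 ^ (k - l) *
        (k.choose l : ℚ) * coeff (n - k) (littleSchroderSeries ^ (k - l)) := by
  have hR : (PowerSeries.mk fun i => (Nat.largeSchroder i : ℚ)) = 2 * littleSchroderSeries - 1 := by
    rw [← map_largeSchroderSeries_eq]
    ext i
    simp
  rw [partialBell_factorial_mul_eq hkn, hR, sub_eq_neg_add, add_pow, map_sum]
  congr 1
  refine Finset.sum_congr rfl fun l _ => ?_
  have : ((-1) ^ l * (2 * littleSchroderSeries) ^ (k - l) * (k.choose l) : ℚ⟦X⟧) =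
      C ((-1 : ℚ) ^ l * 2 ^ (k - l) * (k.choose l : ℚ)) * littleSchroderSeries ^ (k - l) := by
    simp only [map_mul, map_pow, map_neg, map_one, map_ofNat, map_natCast]
    ring
  rw [this, coeff_C_mul]

/-- The large Schröder numbers `r₀, r₁, … = 1, 2, 6, 22, …` are Mathlib's `Nat.largeSchroder`. -/
theorem mainTheorem5 (n k : ℕ) (hk : 1 ≤ k) (hkn : k < n) :
    partialBell n k (fun i => ((i + 1)! : ℚ) * (Nat.largeSchroder i : ℚ)) =
        ∑ l ∈ Finset.range (k + 1), (-1 : ℚ) ^ l * 2 ^ (k - l) * (n.choose l : ℚ) *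
          partialBell (n - l) (k - l) (fun i => ((i + 1)! : ℚ) * (littleSchroder i : ℚ)) ∧
    partialBell n k (fun i => ((i + 1)! : ℚ) * (Nat.largeSchroder i : ℚ)) =
        (n ! : ℚ) / ((k - 1)! : ℚ) *
          ∑ l ∈ Finset.range (k + 1), ∑ j ∈ Finset.Icc 1 (n - k),
            (-1 : ℚ) ^ l * 2 ^ (k - l) / (j : ℚ) *
              ((k - 1).choose l : ℚ) * ((n - k - 1).choose (j - 1) : ℚ) *
              ((n - l + j - 1).choose (j - 1) : ℚ) := by
  constructor
  · rw [partialBell_largeSchroder_eq_sum hkn.le, Finset.mul_sum]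
    refine Finset.sum_congr rfl fun l hl => ?_
    have hlk : l ≤ k := Nat.lt_succ_iff.1 (Finset.mem_range.1 hl)
    rw [partialBell_factorial_mul_eq (by omega), show n - l - (k - l) = n - k by omega,
      Nat.cast_choose ℚ hlk, Nat.cast_choose ℚ (hlk.trans hkn.le),
      PowerSeries.littleSchroderSeries]
    have h1 : ((n - l)! : ℚ) ≠ 0 := Nat.cast_ne_zero.2 (Nat.factorial_ne_zero _)
    have h2 : (k ! : ℚ) ≠ 0 := Nat.cast_ne_zero.2 (Nat.factorial_ne_zero _)
    field_simp
  · rw [partialBell_largeSchroder_eq_sum hkn.le, Finset.mul_sum, Finset.mul_sum]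
    refine Finset.sum_congr rfl fun l hl => ?_
    have hlk : l ≤ k := Nat.lt_succ_iff.1 (Finset.mem_range.1 hl)
    rw [PowerSeries.coeff_littleSchroderSeries_pow (by omega)]
    -- The factor `k - l` is the exponent `p` from Lagrange inversion; the resulting `k` turns `1 /
    -- k!` into `1 / (k - 1)!`.
    have hchoose : (k.choose l : ℚ) * ((k - l : ℕ) : ℚ) = k * ((k - 1).choose l : ℚ) := by
      obtain ⟨k, rfl⟩ := Nat.exists_eq_add_of_le' hk
      have := Nat.choose_mul_succ_eq k l
      rw [Nat.add_sub_cancel, mul_comm ((k + 1 : ℕ) : ℚ)]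
      exact_mod_cast this.symm
    have hfac : (k ! : ℚ) = k * ((k - 1)! : ℚ) := by
      exact_mod_cast (Nat.mul_factorial_pred (by omega)).symm
    have h1 : ((k - 1)! : ℚ) ≠ 0 := Nat.cast_ne_zero.2 (Nat.factorial_ne_zero _)
    have h2 : (k : ℚ) ≠ 0 := by positivity
    have hsum : ∑ j ∈ Finset.Icc 1 (n - k), (-1 : ℚ) ^ l * 2 ^ (k - l) / (j : ℚ) *
          ((k - 1).choose l : ℚ) * ((n - k - 1).choose (j - 1) : ℚ) *
          ((n - l + j - 1).choose (j - 1) : ℚ) =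
        (-1 : ℚ) ^ l * 2 ^ (k - l) * ((k - 1).choose l : ℚ) *
          ∑ j ∈ Finset.Icc 1 (n - k), (1 / j : ℚ) * ((n - k - 1).choose (j - 1) : ℚ) *
            ((n - k + (k - l) + j - 1).choose (j - 1) : ℚ) := by
      rw [Finset.mul_sum, show n - k + (k - l) = n - l by omega]
      refine Finset.sum_congr rfl fun j _ => ?_
      ring
    rw [hsum, hfac]
    generalize ∑ j ∈ Finset.Icc 1 (n - k), (1 / j : ℚ) * ((n - k - 1).choose (j - 1) : ℚ) *
      ((n - k + (k - l) + j - 1).choose (j - 1) : ℚ) = A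
    field_simp
    linear_combination A * hchoose
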